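/- All graphs are finite, simple, undirected and nonempty. For a connected graph $G$ with distance $d$ and vertex eccentricities $e(v)=\max_u d(v,u)$, the eccentricity matrix $\epsilon(G)$ has $(u,v)$ entry $d(u,v)$ if $d(u,v)=\min\{e(u),e(v)\}$ and $0$ otherwise; the $\epsilon$-spectrum of $G$ is the multiset of eigenvalues of $\epsilon(G)$. The central graph $C[G]$ is obtained from $G$ by inserting a new vertex on each edge and joining each pair of distinct vertices of $G$ that are not adjacent in $G$ (adjacent vertices of $G$ are not adjacent in $C[G]$). The central edge join $C[G_1]\veebar G_2$ is obtained from disjoint copies of $C[G_1]$ and $G_2$ by joining every new vertex of $C[G_1]$ (those corresponding to the edges of $G_1$) to every vertex of $G_2$. **Theorem.** Let $G_1$ be a triangle-free $r_1$-regular graph with $p_1$ vertices and $q_1$ edges, where $r_1\ge 2$, and let $G_2$ be an $r_2$-regular graph with $p_2$ vertices. Let $r_1,\lambda_2,\dots,\lambda_{p_1}$ and $r_2,\beta_2,\dots,\beta_{p_2}$ be the adjacency eigenvalues of $G_1$ and $G_2$, listed with multiplicity. Then $q_1\ge p_1$, and the $\epsilon$-spectrum of $C[G_1]\veebar G_2$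 consists, counted with multiplicity, of 1. $-2$ with multiplicity $q_1-p_1$; 2. $-2(1+\beta_j)$ for $j=2,\dots,p_2$; 3. $(\lambda_i-1)\pm\sqrt{(\lambda_i+1)^2+4(\lambda_i+r_1)}$ for $i=2,\dots,p_1$ (both signs for each $i$); 4. the three eigenvalues of the matrix $$\begin{pmatrix}2r_1&2(q_1-r_1)&2p_2\\2(p_1-2)&2(q_1-1)&0\\2p_1&0&2(p_2-1-r_2)\end{pmatrix}.$$ If instead $r_1=1$ and $q_1\ge 2$, so that $q_1-p_1<0$, the same holds with item 1 read as the removal of $p_1-q_1$ copies of $-2$: the $\epsilon$-spectrum together with $p_1-q_1$ further copies of $-2$ is the multiset formed by items 2, 3 and 4. -/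

import Mathlib

/-- The central graph `C[G]`: the vertices are those of `G` together with one new vertex for each
edge of `G`.  A new vertex is joined to the two ends of its edge, and two distinct vertices of `G`
are joined exactly when they are not adjacent in `G`. -/
def centralGraph {V : Type*} (G : SimpleGraph V) : SimpleGraph (V ⊕ G.edgeSet) where
  Adj
    | .inl u, .inl v => u ≠ v ∧ ¬ G.Adj u v
    | .inl u, .inr e => u ∈ (e : Sym2 V)
    | .inr e, .inl u => u ∈ (e : Sym2 V)
    | .inr _, .inr _ => False
  symm := ⟨by
    rintro (u | e) (v | f) h
    · exact ⟨h.1.symm, fun h' => h.2 h'.symm⟩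
    · exact h
    · exact h
    · exact h⟩
  loopless := ⟨by
    rintro (u | e) h
    · exact h.1 rfl
    · exact h⟩

/-- The central edge join of `G₁` and `G₂`: the disjoint union of `C[G₁]` and `G₂`, in which
moreover each vertex of `C[G₁]` coming from an edge of `G₁` is joined to every vertex of `G₂`. -/
def centralEdgeJoin {V₁ V₂ : Type*} (G₁ : SimpleGraph V₁) (G₂ : SimpleGraph V₂) :
    SimpleGraph ((V₁ ⊕ G₁.edgeSet) ⊕ V₂) where
  Adj
    | .inl x, .inl y => (centralGraph G₁).Adj x y
    | .inr v, .inr w => G₂.Adj v w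
    | .inl (.inr _), .inr _ => True
    | .inr _, .inl (.inr _) => True
    | .inl (.inl _), .inr _ => False
    | .inr _, .inl (.inl _) => False
  symm := ⟨by
    rintro ((u | e) | v) ((u' | e') | v') h
    all_goals first | exact h | exact SimpleGraph.Adj.symm h⟩
  loopless := ⟨by
    rintro (x | v) h
    · exact (centralGraph G₁).irrefl h
    · exact G₂.irrefl h⟩

open Classical in
/-- The eccentricity matrix of a graph: the `(u, v)` entry is `d(u, v)` if
`d(u, v) = min {e(u), e(v)}`, and `0` otherwise. -/
noncomputable def eccMatrix {V : Type*} (G : SimpleGraph V) : Matrix V V ℝ :=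
  Matrix.of fun u v =>
    if G.edist u v = min (G.eccent u) (G.eccent v) then (G.dist u v : ℝ) else 0

/-- The real eigenvalues of a square real matrix, listed with algebraic multiplicity. -/
noncomputable def matrixSpec {n : Type*} [Fintype n] [DecidableEq n] (M : Matrix n n ℝ) :
    Multiset ℝ :=
  M.charpoly.roots

/-- The spectrum of the adjacency matrix, with multiplicities. -/
noncomputable def adjSpec {V : Type*} [Fintype V] [DecidableEq V] (G : SimpleGraph V)
    [DecidableRel G.Adj] : Multiset ℝ :=
  matrixSpec (G.adjMatrix ℝ)

/-- The spectrum of the eccentricity matrix, with multiplicities. -/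
noncomputable def eccSpec {V : Type*} [Fintype V] [DecidableEq V] (G : SimpleGraph V) :
    Multiset ℝ :=
  matrixSpec (eccMatrix G)

/-! The join has diameter 2 and no vertex is adjacent to all others, so every eccentricity is 2 and
the eccentricity matrix is `2 (J - I - A)`. By regularity, the partition into vertices of `G₁`,
edges of `G₁` and vertices of `G₂` is equitable. Hence `xI - ε = N - U K`, where `U` is the
indicator matrix of the partition, `U K` collects the all-ones blocks, and `N U = U B` with `B` of
size 3. Then `det (N - U K) * det B = det N * det (B - K U)`, and `B - K U` is the characteristic
matrix of the 3×3 matrix of item 4. A Schur complement with `M Mᵀ = A + r₁ I` factors `det N` over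
the two adjacency spectra; `det B` is the factor belonging to `r₁` and `r₂`, and it cancels. -/

open Matrix Polynomial

/-! ### Eccentricity matrix when all eccentricities are 2. -/

section Eccentricity

variable {V : Type*} {G : SimpleGraph V}

lemma eccMatrix_apply_of_edist_le_two (hd : ∀ u v, G.edist u v ≤ 2)
    (he : ∀ u, ∃ v, u ≠ v ∧ ¬ G.Adj u v) [DecidableEq V] [DecidableRel G.Adj] (u v : V) :
    eccMatrix G u v = if u = v ∨ G.Adj u v then 0 else 2 := by
  have key : ∀ u v, u ≠ v → ¬ G.Adj u v → G.edist u v = 2 := fun u v huv hadj => by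
    refine le_antisymm (hd u v) ?_
    by_contra! h
    have h1 : G.edist u v ≤ 1 := Order.le_of_lt_add_one (by simpa [one_add_one_eq_two] using h)
    rcases SimpleGraph.edist_le_one_iff_adj_or_eq.1 h1 with h | h
    exacts [hadj h, huv h]
  have hecc : ∀ u, G.eccent u = 2 := fun u => by
    refine le_antisymm ((SimpleGraph.eccent_le_iff _ _).2 (hd u)) ?_
    obtain ⟨v, huv, hadj⟩ := he u
    exact (key u v huv hadj) ▸ SimpleGraph.edist_le_eccent
  simp only [eccMatrix, Matrix.of_apply, hecc, min_self]
  by_cases huv : u = v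
  · simp [huv]
  by_cases hadj : G.Adj u v
  · have : G.edist u v = 1 := SimpleGraph.edist_eq_one_iff_adj.2 hadj
    simp [hadj, this]
  · have h := key u v huv hadj
    simp [huv, hadj, h, SimpleGraph.dist]

end Eccentricity

/-! ### Distances in the central edge join. -/

section Join

variable {V₁ V₂ : Type*} {G₁ : SimpleGraph V₁} {G₂ : SimpleGraph V₂}

lemma centralEdgeJoin_edist_le_two [Nonempty V₁] [Nonempty V₂] (htri : G₁.CliqueFree 3)
    (hnb : ∀ u, ∃ v, G₁.Adj u v) (x y : (V₁ ⊕ G₁.edgeSet) ⊕ V₂) :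
    (centralEdgeJoin G₁ G₂).edist x y ≤ 2 := by
  have two : ∀ {x y z : (V₁ ⊕ G₁.edgeSet) ⊕ V₂}, (centralEdgeJoin G₁ G₂).Adj x z →
      (centralEdgeJoin G₁ G₂).Adj z y → (centralEdgeJoin G₁ G₂).edist x y ≤ 2 :=
    fun h h' => SimpleGraph.edist_le (h.toWalk.append h'.toWalk)
  have one : ∀ {x y : (V₁ ⊕ G₁.edgeSet) ⊕ V₂}, (centralEdgeJoin G₁ G₂).Adj x y →
      (centralEdgeJoin G₁ G₂).edist x y ≤ 2 :=
    fun h => (SimpleGraph.edist_eq_one_iff_adj.2 h).le.trans (by norm_num)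
  have vertex_edge : ∀ (u : V₁) (e : G₁.edgeSet),
      (centralEdgeJoin G₁ G₂).edist (.inl (.inl u)) (.inl (.inr e)) ≤ 2 := by
    rintro u ⟨e, he⟩
    induction e using Sym2.ind with
    | _ a b =>
    by_cases hu : u ∈ s(a, b)
    · exact one (show (centralEdgeJoin G₁ G₂).Adj _ _ from hu)
    have hab : G₁.Adj a b := he
    simp only [Sym2.mem_iff, not_or] at hu
    -- Without triangles, `u` misses an end of the edge in `G₁`; that end is a neighbour of `u` in
    -- the central graph.
    by_cases ha : G₁.Adj u a
    · have hb : ¬ G₁.Adj u b := fun hb => by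
        classical
        exact htri {u, a, b} (SimpleGraph.is3Clique_triple_iff.2 ⟨ha, hb, hab⟩)
      refine two (z := .inl (.inl b)) ⟨hu.2, hb⟩ ?_
      exact Sym2.mem_mk_right a b
    · refine two (z := .inl (.inl a)) ⟨hu.1, ha⟩ ?_
      exact Sym2.mem_mk_left a b
  have vertex_right : ∀ (u : V₁) (w : V₂),
      (centralEdgeJoin G₁ G₂).edist (.inl (.inl u)) (.inr w) ≤ 2 := by
    intro u w
    obtain ⟨v, huv⟩ := hnb u
    refine two (z := .inl (.inr ⟨s(u, v), huv⟩)) ?_ trivial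
    exact Sym2.mem_mk_left u v
  rcases x with (u | e) | w <;> rcases y with (v | f) | w'
  · by_cases huv : u = v
    · simp [huv]
    by_cases hadj : G₁.Adj u v
    · exact two (z := .inl (.inr ⟨s(u, v), hadj⟩)) (Sym2.mem_mk_left u v) (Sym2.mem_mk_right u v)
    · exact one (show (centralEdgeJoin G₁ G₂).Adj _ _ from ⟨huv, hadj⟩)
  · exact vertex_edge u f
  · exact vertex_right u w'
  · rw [SimpleGraph.edist_comm]; exact vertex_edge v e
  · exact two (z := .inr (Classical.arbitrary V₂)) trivial trivial
  · exact one (show (centralEdgeJoin G₁ G₂).Adj _ _ from trivial)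
  · rw [SimpleGraph.edist_comm]; exact vertex_right v w
  · exact one (show (centralEdgeJoin G₁ G₂).Adj _ _ from trivial)
  · obtain ⟨v, huv⟩ := hnb (Classical.arbitrary V₁)
    exact two (z := .inl (.inr ⟨s(_, v), huv⟩)) trivial trivial

/-- A second edge supplies the non-neighbour of an edge vertex. -/
lemma centralEdgeJoin_exists_not_adj [Nonempty V₁] [Nonempty V₂] [Nontrivial G₁.edgeSet]
    (x : (V₁ ⊕ G₁.edgeSet) ⊕ V₂) : ∃ y, x ≠ y ∧ ¬ (centralEdgeJoin G₁ G₂).Adj x y := by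
  rcases x with (u | e) | w
  · exact ⟨.inr (Classical.arbitrary V₂), by simp, id⟩
  · obtain ⟨f, hf⟩ := exists_ne e
    exact ⟨.inl (.inr f), by simpa using hf.symm, id⟩
  · exact ⟨.inl (.inl (Classical.arbitrary V₁)), by simp, id⟩

end Join

/-! ### Determinant identities. -/

section Determinants

lemma det_sub_mul_mul_det_of_mul_eq_mul {R n k : Type*} [CommRing R] [Fintype n] [DecidableEq n]
    [Fintype k] [DecidableEq k] {N : Matrix n n R} {U : Matrix n k R} {B : Matrix k k R}
    (K : Matrix k n R) (h : N * U = U * B) :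
    (N - U * K).det * B.det = N.det * (B - K * U).det := by
  have hprod : fromBlocks N U K 1 * fromBlocks 1 (-U) 0 B = fromBlocks N 0 K (B - K * U) := by
    rw [fromBlocks_multiply]
    simp [h, sub_eq_neg_add]
  have := congrArg det hprod
  rwa [det_mul, det_fromBlocks_one₂₂, det_fromBlocks_zero₂₁, det_fromBlocks_zero₁₂, det_one,
    one_mul] at this

/-- Schur complement with denominators cleared, so that `y = 0` is allowed. -/
lemma det_fromBlocks_smul_one_mul_pow {R m n : Type*} [CommRing R] [Fintype m] [DecidableEq m]
    [Fintype n] [DecidableEq n] (A : Matrix m m R) (B : Matrix m n R) (C : Matrix n m R) (y : R) :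
    (fromBlocks A B C (y • 1)).det * y ^ Fintype.card m =
      (y • A - B * C).det * y ^ Fintype.card n := by
  have hprod : fromBlocks A B C (y • 1) * fromBlocks (y • 1) 0 (-C) 1 =
      fromBlocks (y • A - B * C) B 0 (y • 1) := by
    rw [fromBlocks_multiply]
    simp [sub_eq_add_neg]
  have := congrArg det hprod
  rwa [det_mul, det_fromBlocks_zero₁₂, det_fromBlocks_zero₂₁, det_one, mul_one, det_smul, det_one,
    mul_one, det_smul, det_one, mul_one] at this

lemma Matrix.IsHermitian.det_smul_one_add_smul {n : Type*} [Fintype n] [DecidableEq n]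
    {A : Matrix n n ℝ} (hA : A.IsHermitian) (a b : ℝ) :
    (a • (1 : Matrix n n ℝ) + b • A).det = (A.charpoly.roots.map fun l => a + b * l).prod := by
  rw [hA.roots_charpoly_eq_eigenvalues, Multiset.map_map]
  by_cases hb : b = 0
  · simp [hb]
  have h : a • (1 : Matrix n n ℝ) + b • A = (-b) • (scalar n (-a / b) - A) := by
    have hab : -b * (-a / b) = a := by field_simp
    rw [scalar_apply, ← smul_one_eq_diagonal, smul_sub, smul_smul, hab, neg_smul, sub_neg_eq_add]
  rw [h, det_smul, ← eval_charpoly, hA.charpoly_eq, eval_prod, ← Finset.card_univ,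
    ← Finset.prod_const, ← Finset.prod_mul_distrib]
  refine Finset.prod_congr rfl fun i _ => ?_
  simp
  field_simp
  ring

end Determinants

/-! ### Incidence matrix and adjacency spectrum of a regular graph. -/

section Incidence

lemma sum_edgeSet_eq_sum {V : Type*} {G : SimpleGraph V}
    [Fintype G.edgeSet] [Fintype (Sym2 V)] {f : Sym2 V → ℝ} (hf : ∀ e ∉ G.edgeSet, f e = 0) :
    ∑ e : G.edgeSet, f e = ∑ e, f e := by
  rw [← Finset.sum_subset (Finset.subset_univ G.edgeFinset)
    (fun e _ he => hf e (by simpa using he))]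
  exact (Finset.sum_subtype G.edgeFinset (by simp) f).symm

lemma isHermitian_adjMatrix {V : Type*} (G : SimpleGraph V) [DecidableRel G.Adj] :
    (G.adjMatrix ℝ).IsHermitian := by
  rw [IsHermitian, conjTranspose_eq_transpose_of_trivial, SimpleGraph.transpose_adjMatrix]

variable {V : Type*} [DecidableEq V] (G : SimpleGraph V) [DecidableRel G.Adj]

/-- The vertex-edge incidence matrix, with columns indexed by the edges only. -/
def edgeIncMatrix : Matrix V G.edgeSet ℝ :=
  (G.incMatrix ℝ).submatrix id (↑)

variable {G}

lemma edgeIncMatrix_apply (u : V) (e : G.edgeSet) :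
    edgeIncMatrix G u e = if u ∈ (e : Sym2 V) then 1 else 0 := by
  simp [edgeIncMatrix, SimpleGraph.incMatrix_apply', SimpleGraph.incidenceSet, e.2]

variable [Fintype V]

lemma sum_edgeIncMatrix_row {r : ℕ} (hr : G.IsRegularOfDegree r) (u : V) :
    ∑ e, edgeIncMatrix G u e = r := by
  have h := SimpleGraph.sum_incMatrix_apply (R := ℝ) G (a := u)
  rw [hr.degree_eq u] at h
  rw [← h]
  exact sum_edgeSet_eq_sum (f := fun e => G.incMatrix ℝ u e) fun e he =>
    SimpleGraph.incMatrix_of_notMem_incidenceSet _ fun h => he h.1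

lemma sum_edgeIncMatrix_col (e : G.edgeSet) : ∑ u, edgeIncMatrix G u e = 2 :=
  SimpleGraph.sum_incMatrix_apply_of_mem_edgeSet G e.2

lemma edgeIncMatrix_mul_transpose {r : ℕ} (hr : G.IsRegularOfDegree r) :
    edgeIncMatrix G * (edgeIncMatrix G)ᵀ = G.adjMatrix ℝ + (r : ℝ) • 1 := by
  ext u v
  have h := congrFun₂ (SimpleGraph.incMatrix_mul_transpose (R := ℝ) G) u v
  have h' : (edgeIncMatrix G * (edgeIncMatrix G)ᵀ) u v =
      (G.incMatrix ℝ * (G.incMatrix ℝ)ᵀ) u v := by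
    simp only [mul_apply, transpose_apply]
    exact sum_edgeSet_eq_sum (f := fun e => G.incMatrix ℝ u e * G.incMatrix ℝ v e) fun e he => by
      rw [SimpleGraph.incMatrix_of_notMem_incidenceSet _ fun h => he h.1, zero_mul]
  rw [h', h]
  by_cases huv : u = v
  · subst huv; simp [hr.degree_eq]
  · simp [huv, SimpleGraph.adjMatrix_apply]

lemma nonempty_of_adjSpec_eq_cons {a : ℝ} {s : Multiset ℝ} (h : adjSpec G = a ::ₘ s) :
    Nonempty V := by
  by_contra hV
  rw [not_nonempty_iff] at hV
  simp [adjSpec, matrixSpec, charpoly] at h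

/-- `A + r I = M Mᵀ` is positive semidefinite. This makes the radicands in item 3 nonnegative. -/
lemma add_degree_nonneg_of_mem_adjSpec {r : ℕ} (hr : G.IsRegularOfDegree r) {l : ℝ} (hl : l ∈ adjSpec G) :
    0 ≤ l + r := by
  have hA := isHermitian_adjMatrix G
  have hpsd : (G.adjMatrix ℝ + (r : ℝ) • 1).PosSemidef := by
    rw [← edgeIncMatrix_mul_transpose hr]
    simpa using posSemidef_self_mul_conjTranspose (edgeIncMatrix G)
  rw [adjSpec, matrixSpec, hA.roots_charpoly_eq_eigenvalues, Multiset.mem_map] at hl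
  obtain ⟨i, -, rfl⟩ := hl
  have h := hpsd.dotProduct_mulVec_nonneg (hA.eigenvectorBasis i)
  have hv : star (hA.eigenvectorBasis i : V → ℝ) ⬝ᵥ (hA.eigenvectorBasis i : V → ℝ) = 1 := by
    have := (hA.eigenvectorBasis).orthonormal.1 i
    have h2 := EuclideanSpace.inner_eq_star_dotProduct (𝕜 := ℝ) (hA.eigenvectorBasis i)
      (hA.eigenvectorBasis i)
    rw [real_inner_self_eq_norm_sq, this] at h2
    simpa using h2.symm
  rw [add_mulVec, hA.mulVec_eigenvectorBasis, smul_mulVec, one_mulVec, ← add_smul,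
    dotProduct_smul, hv] at h
  simpa using h

end Incidence

/-! ### Characteristic polynomial of the eccentricity matrix. -/

section Spectrum

variable {V₁ V₂ : Type*} [Fintype V₁] [DecidableEq V₁] [Fintype V₂] [DecidableEq V₂]
  {G₁ : SimpleGraph V₁} [DecidableRel G₁.Adj] {G₂ : SimpleGraph V₂} [DecidableRel G₂.Adj]

/-- The block of the vertex partition of the central edge join into the vertices of the first
graph, its edges, and the vertices of the second graph. -/
def joinPart {α β γ : Type*} : (α ⊕ β) ⊕ γ → Fin 3
  | .inl (.inl _) => 0
  | .inl (.inr _) => 1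
  | .inr _ => 2

/-- The indicator matrix of the partition `joinPart`. -/
def joinPartMatrix (α β γ : Type*) : Matrix ((α ⊕ β) ⊕ γ) (Fin 3) ℝ :=
  of fun x k => if joinPart x = k then 1 else 0

variable (G₁ G₂) in
/-- The characteristic matrix of the eccentricity matrix of the central edge join at `x`, with
all multiples of all-ones blocks taken out. -/
noncomputable def joinCore (x : ℝ) :
    Matrix ((V₁ ⊕ G₁.edgeSet) ⊕ V₂) ((V₁ ⊕ G₁.edgeSet) ⊕ V₂) ℝ :=
  fromBlocks
    (fromBlocks (x • 1 - (2 : ℝ) • G₁.adjMatrix ℝ) ((2 : ℝ) • edgeIncMatrix G₁)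
      ((2 : ℝ) • (edgeIncMatrix G₁)ᵀ) ((x + 2) • 1))
    0 0 ((x + 2) • 1 + (2 : ℝ) • G₂.adjMatrix ℝ)

/-- The quotient of `joinCore` by the partition `joinPart`. -/
noncomputable def joinCoreQuotient (r₁ r₂ x : ℝ) : Matrix (Fin 3) (Fin 3) ℝ :=
  !![x - 2 * r₁, 2 * r₁, 0; 4, x + 2, 0; 0, 0, x + 2 + 2 * r₂]

/-- The multiples of all-ones blocks in the eccentricity matrix of the central edge join. -/
def joinOnes (α β γ : Type*) : Matrix (Fin 3) ((α ⊕ β) ⊕ γ) ℝ :=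
  of fun k x => !![0, 2, 2; 2, 2, 0; 2, 0, 2] k (joinPart x)

lemma scalar_sub_eccMatrix_centralEdgeJoin
    (hecc : ∀ (_ : DecidableRel (centralEdgeJoin G₁ G₂).Adj) x y,
      eccMatrix (centralEdgeJoin G₁ G₂) x y =
        if x = y ∨ (centralEdgeJoin G₁ G₂).Adj x y then 0 else 2) (x : ℝ) :
    scalar _ x - eccMatrix (centralEdgeJoin G₁ G₂) =
      joinCore G₁ G₂ x - joinPartMatrix V₁ G₁.edgeSet V₂ * joinOnes V₁ G₁.edgeSet V₂ := by
  classical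
  have hmul : ∀ i j, (joinPartMatrix V₁ G₁.edgeSet V₂ * joinOnes V₁ G₁.edgeSet V₂) i j =
      !![(0 : ℝ), 2, 2; 2, 2, 0; 2, 0, 2] (joinPart i) (joinPart j) := by
    intro i j
    simp [mul_apply, joinPartMatrix, joinOnes]
  ext i j
  rw [Matrix.sub_apply, Matrix.sub_apply, hmul, hecc (Classical.decRel _)]
  rcases i with (u | e) | w <;> rcases j with (v | f) | w' <;>
    simp [joinCore, joinPart, centralEdgeJoin, centralGraph, one_apply, diagonal_apply,
      edgeIncMatrix_apply, SimpleGraph.adjMatrix_apply]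
  · by_cases huv : u = v
    · simp [huv]
    · by_cases hadj : G₁.Adj u v <;> simp [huv, hadj]
  · split_ifs <;> norm_num
  · split_ifs <;> norm_num
  · split_ifs <;> ring
  · by_cases hw : w = w'
    · subst hw; simp
    · by_cases hadj : G₂.Adj w w' <;> simp [hw, hadj]

lemma joinCore_mul_joinPartMatrix {r₁ r₂ : ℕ} (hr₁ : G₁.IsRegularOfDegree r₁)
    (hr₂ : G₂.IsRegularOfDegree r₂) (x : ℝ) :
    joinCore G₁ G₂ x * joinPartMatrix V₁ G₁.edgeSet V₂ =
      joinPartMatrix V₁ G₁.edgeSet V₂ * joinCoreQuotient r₁ r₂ x := by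
  have hA₁ : ∀ u, ∑ v, G₁.adjMatrix ℝ u v = r₁ := fun u => by
    simp [SimpleGraph.adjMatrix_apply, ← SimpleGraph.card_neighborFinset_eq_degree, ← hr₁.degree_eq u, SimpleGraph.neighborFinset_eq_filter]
  have hA₂ : ∀ u, ∑ v, G₂.adjMatrix ℝ u v = r₂ := fun u => by
    simp [SimpleGraph.adjMatrix_apply, ← SimpleGraph.card_neighborFinset_eq_degree, ← hr₂.degree_eq u, SimpleGraph.neighborFinset_eq_filter]
  ext i k
  simp only [mul_apply, Fintype.sum_sum_type]
  rcases i with (u | e) | w <;> fin_cases k <;>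
    simp [joinCore, joinPartMatrix, joinPart, joinCoreQuotient, Fin.sum_univ_three,
      Finset.sum_sub_distrib, Finset.sum_add_distrib, ← Finset.mul_sum, hA₁, hA₂,
      sum_edgeIncMatrix_row hr₁, sum_edgeIncMatrix_col, one_apply,
      -SimpleGraph.adjMatrix_apply]
  norm_num

lemma joinCoreQuotient_sub_mul (r₁ r₂ x : ℝ) (α β γ : Type*) [Fintype α] [Fintype β] [Fintype γ] :
    joinCoreQuotient r₁ r₂ x - joinOnes α β γ * joinPartMatrix α β γ =
      scalar (Fin 3) x -
        !![2 * r₁, 2 * (Fintype.card β - r₁), 2 * (Fintype.card γ : ℝ);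
          2 * ((Fintype.card α : ℝ) - 2), 2 * ((Fintype.card β : ℝ) - 1), 0;
          2 * (Fintype.card α : ℝ), 0, 2 * ((Fintype.card γ : ℝ) - 1 - r₂)] := by
  ext k l
  rw [Matrix.sub_apply, mul_apply]
  simp only [Fintype.sum_sum_type]
  fin_cases k <;> fin_cases l <;>
    simp [joinCoreQuotient, joinOnes, joinPartMatrix, joinPart] <;> ring

lemma joinCore_det_mul_pow {r₁ : ℕ} (hr₁ : G₁.IsRegularOfDegree r₁) (x : ℝ) :
    (joinCore G₁ G₂ x).det * (x + 2) ^ Fintype.card V₁ =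
      (x + 2) ^ Fintype.card G₁.edgeSet *
        ((adjSpec G₁).map fun l => (x ^ 2 - (2 * l - 2) * x - 8 * l - 4 * r₁)).prod *
        ((adjSpec G₂).map fun b => x + 2 + 2 * b).prod := by
  have hschur : (x + 2) • (x • 1 - (2 : ℝ) • G₁.adjMatrix ℝ) -
      ((2 : ℝ) • edgeIncMatrix G₁) * ((2 : ℝ) • (edgeIncMatrix G₁)ᵀ) =
      ((x + 2) * x - 4 * r₁) • (1 : Matrix V₁ V₁ ℝ) + (-2 * x - 8) • G₁.adjMatrix ℝ := by
    rw [Matrix.smul_mul, Matrix.mul_smul, smul_smul, edgeIncMatrix_mul_transpose hr₁]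
    module
  have h := det_fromBlocks_smul_one_mul_pow (x • 1 - (2 : ℝ) • G₁.adjMatrix ℝ)
    ((2 : ℝ) • edgeIncMatrix G₁) ((2 : ℝ) • (edgeIncMatrix G₁)ᵀ) (x + 2)
  rw [hschur, (isHermitian_adjMatrix G₁).det_smul_one_add_smul] at h
  rw [joinCore, det_fromBlocks_zero₂₁, mul_right_comm, h,
    (isHermitian_adjMatrix G₂).det_smul_one_add_smul, mul_comm (Multiset.prod _)]
  simp only [adjSpec, matrixSpec]
  congr 3
  refine Multiset.map_congr rfl fun l _ => ?_
  ring

lemma joinCoreQuotient_det (r₁ r₂ x : ℝ) : (joinCoreQuotient r₁ r₂ x).det =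
    (x ^ 2 - (2 * r₁ - 2) * x - 8 * r₁ - 4 * r₁) * (x + 2 + 2 * r₂) := by
  simp [joinCoreQuotient, det_fin_three]
  ring

/-- Keeping `p₁` copies of `-2` on the left avoids the sign of `q₁ - p₁` and serves both cases. -/
lemma eccSpec_centralEdgeJoin_add_replicate {p₁ q₁ r₁ p₂ r₂ : ℕ} [Nontrivial G₁.edgeSet]
    (hp₁ : Fintype.card V₁ = p₁) (hq₁ : G₁.edgeFinset.card = q₁) (hp₂ : Fintype.card V₂ = p₂)
    (hr₁ : G₁.IsRegularOfDegree r₁) (hr₂ : G₂.IsRegularOfDegree r₂) (htri : G₁.CliqueFree 3)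
    (hpos : 0 < r₁) {lam β : Multiset ℝ}
    (hlam : adjSpec G₁ = (r₁ : ℝ) ::ₘ lam) (hβ : adjSpec G₂ = (r₂ : ℝ) ::ₘ β) :
    eccSpec (centralEdgeJoin G₁ G₂) + Multiset.replicate p₁ (-2 : ℝ) =
      Multiset.replicate q₁ (-2 : ℝ)
      + β.map (fun b => -2 * (1 + b))
      + lam.map (fun l => (l - 1) + √((l + 1) ^ 2 + 4 * (l + r₁)))
      + lam.map (fun l => (l - 1) - √((l + 1) ^ 2 + 4 * (l + r₁)))
      + matrixSpec
        !![2 * (r₁ : ℝ), 2 * ((q₁ : ℝ) - r₁), 2 * (p₂ : ℝ);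
           2 * ((p₁ : ℝ) - 2), 2 * ((q₁ : ℝ) - 1), 0;
           2 * (p₁ : ℝ), 0, 2 * ((p₂ : ℝ) - 1 - r₂)] := by
  have hne₁ : Nonempty V₁ := nonempty_of_adjSpec_eq_cons hlam
  have hne₂ : Nonempty V₂ := nonempty_of_adjSpec_eq_cons hβ
  have hnb : ∀ u, ∃ v, G₁.Adj u v := fun u => by
    rw [← SimpleGraph.degree_pos_iff_exists_adj, hr₁.degree_eq u]
    exact hpos
  have hqc : Fintype.card G₁.edgeSet = q₁ := by
    rw [← hq₁, SimpleGraph.edgeFinset_card]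
  set Q : Matrix (Fin 3) (Fin 3) ℝ :=
    !![2 * (r₁ : ℝ), 2 * ((q₁ : ℝ) - r₁), 2 * (p₂ : ℝ);
       2 * ((p₁ : ℝ) - 2), 2 * ((q₁ : ℝ) - 1), 0;
       2 * (p₁ : ℝ), 0, 2 * ((p₂ : ℝ) - 1 - r₂)] with hQ
  have hdet : ∀ x : ℝ, (eccMatrix (centralEdgeJoin G₁ G₂)).charpoly.eval x *
      (joinCoreQuotient r₁ r₂ x).det = (joinCore G₁ G₂ x).det * Q.charpoly.eval x := fun x => by
    have h := det_sub_mul_mul_det_of_mul_eq_mul (joinOnes V₁ G₁.edgeSet V₂)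
      (joinCore_mul_joinPartMatrix hr₁ hr₂ x)
    rw [joinCoreQuotient_sub_mul, ← scalar_sub_eccMatrix_centralEdgeJoin (fun _ =>
      eccMatrix_apply_of_edist_le_two (centralEdgeJoin_edist_le_two htri hnb)
        centralEdgeJoin_exists_not_adj) x, ← eval_charpoly, ← eval_charpoly, hqc, hp₁, hp₂] at h
    exact h
  let s : ℝ → ℝ := fun l => √((l + 1) ^ 2 + 4 * (l + r₁))
  have hs : ∀ l ∈ lam, ∀ x : ℝ, (x - ((l - 1) + s l)) * (x - ((l - 1) - s l)) =
      x ^ 2 - (2 * l - 2) * x - 8 * l - 4 * r₁ := fun l hl x => by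
    have hl' : 0 ≤ l + r₁ := add_degree_nonneg_of_mem_adjSpec hr₁ (hlam ▸ Multiset.mem_cons_of_mem hl)
    have hsq : s l ^ 2 = (l + 1) ^ 2 + 4 * (l + r₁) := Real.sq_sqrt (by positivity)
    linear_combination -hsq
  let D : ℝ[X] := (X ^ 2 - C (2 * (r₁ : ℝ) - 2) * X - C (8 * (r₁ : ℝ)) - C (4 * (r₁ : ℝ))) *
    (X + C 2 + C (2 * (r₂ : ℝ)))
  have hDeval : ∀ x, D.eval x = (joinCoreQuotient r₁ r₂ x).det := fun x => by
    rw [joinCoreQuotient_det]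
    simp [D]
  have hD : D ≠ 0 := fun h => by
    -- The quadratic factor is `(x - 2 r₁)(x + 2) - 8 r₁`, positive at this point, as is the linear
    -- factor.
    have h0 := hDeval (2 * r₁ + 8)
    rw [h, eval_zero, joinCoreQuotient_det] at h0
    have : (0 : ℝ) < (8 * (2 * r₁ + 10) - 8 * r₁) * (2 * r₁ + 10 + 2 * r₂) := by
      have h1 : (0 : ℝ) ≤ r₁ := r₁.cast_nonneg
      have h2 : (0 : ℝ) ≤ r₂ := r₂.cast_nonneg
      apply mul_pos <;> linarith
    nlinarith
  have hpoly : (eccMatrix (centralEdgeJoin G₁ G₂)).charpoly * (X - C (-2)) ^ p₁ =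
      (X - C (-2)) ^ q₁ * ((β.map fun b => -2 * (1 + b)).map fun a => X - C a).prod *
      ((lam.map fun l => (l - 1) + s l).map fun a => X - C a).prod *
      ((lam.map fun l => (l - 1) - s l).map fun a => X - C a).prod * Q.charpoly := by
    -- Cancelling `D` as a polynomial covers its zeros, where pointwise division would fail.
    refine mul_right_cancel₀ hD (Polynomial.funext fun x => ?_)
    have h1 := hdet x
    have h2 := joinCore_det_mul_pow (G₂ := G₂) hr₁ x
    rw [hlam, hβ, Multiset.map_cons, Multiset.map_cons, Multiset.prod_cons, Multiset.prod_cons,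
      hp₁, hqc] at h2
    have h3 := joinCoreQuotient_det r₁ r₂ x
    have hl : (lam.map fun l => x ^ 2 - (2 * l - 2) * x - 8 * l - 4 * r₁).prod =
        (lam.map fun l => x - ((l - 1) + s l)).prod *
        (lam.map fun l => x - ((l - 1) - s l)).prod := by
      rw [← Multiset.prod_map_mul]
      exact congrArg _ (Multiset.map_congr rfl fun l hl => (hs l hl x).symm)
    have hb : (β.map fun b => x + 2 + 2 * b).prod =
        (β.map fun b => x - (-2 * (1 + b))).prod :=
      congrArg _ (Multiset.map_congr rfl fun b _ => by ring)
    rw [hl, hb] at h2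
    simp only [eval_mul, eval_pow, eval_sub, eval_X, eval_C, hDeval, eval_multiset_prod,
      Multiset.map_map, Function.comp_def, sub_neg_eq_add] at h2 ⊢
    generalize (Multiset.map (fun b => x - -2 * (1 + b)) β).prod = Pb at *
    generalize (Multiset.map (fun l => x - (l - 1 + s l)) lam).prod = Pl at *
    generalize (Multiset.map (fun l => x - (l - 1 - s l)) lam).prod = Pm at *
    linear_combination (x + 2) ^ p₁ * h1 + Q.charpoly.eval x * h2 -
      (x + 2) ^ q₁ * Pb * Pl * Pm * Q.charpoly.eval x * h3
  have hprod : ∀ t : Multiset ℝ, (t.map fun a => (X - C a : ℝ[X])).prod ≠ 0 := fun t =>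
    (monic_multiset_prod_of_monic t _ fun a _ => monic_X_sub_C a).ne_zero
  have hpow : ∀ n : ℕ, (X - C (-2) : ℝ[X]) ^ n ≠ 0 := fun n => pow_ne_zero _ (X_sub_C_ne_zero _)
  have hroots := congrArg roots hpoly
  rw [roots_mul (mul_ne_zero (charpoly_monic _).ne_zero (hpow _)),
    roots_mul (mul_ne_zero (mul_ne_zero (mul_ne_zero (mul_ne_zero (hpow _) (hprod _)) (hprod _))
      (hprod _)) (charpoly_monic _).ne_zero),
    roots_mul (mul_ne_zero (mul_ne_zero (mul_ne_zero (hpow _) (hprod _)) (hprod _)) (hprod _)),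
    roots_mul (mul_ne_zero (mul_ne_zero (hpow _) (hprod _)) (hprod _)),
    roots_mul (mul_ne_zero (hpow _) (hprod _)), roots_multiset_prod_X_sub_C,
    roots_multiset_prod_X_sub_C, roots_multiset_prod_X_sub_C, roots_pow, roots_pow,
    roots_X_sub_C, Multiset.nsmul_singleton, Multiset.nsmul_singleton] at hroots
  exact hroots

end Spectrum

theorem theorem3p13 {V₁ V₂ : Type*} [Fintype V₁] [DecidableEq V₁] [Fintype V₂] [DecidableEq V₂]
    (G₁ : SimpleGraph V₁) [DecidableRel G₁.Adj] (G₂ : SimpleGraph V₂) [DecidableRel G₂.Adj]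
    (p₁ q₁ r₁ p₂ r₂ : ℕ)
    (hp₁ : Fintype.card V₁ = p₁) (hq₁ : G₁.edgeFinset.card = q₁) (hp₂ : Fintype.card V₂ = p₂)
    (hr₁ : G₁.IsRegularOfDegree r₁) (hr₂ : G₂.IsRegularOfDegree r₂)
    (htri : G₁.CliqueFree 3)
    -- `lam` is the list `λ₂, …, λ_{p₁}` and `β` is the list `β₂, …, β_{p₂}`
    (lam β : Multiset ℝ)
    (hlam : adjSpec G₁ = (r₁ : ℝ) ::ₘ lam) (hβ : adjSpec G₂ = (r₂ : ℝ) ::ₘ β) :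
    (2 ≤ r₁ →
      p₁ ≤ q₁ ∧
      eccSpec (centralEdgeJoin G₁ G₂) =
        Multiset.replicate (q₁ - p₁) (-2 : ℝ)
        + β.map (fun b => -2 * (1 + b))
        + lam.map (fun l => (l - 1) + √((l + 1) ^ 2 + 4 * (l + r₁)))
        + lam.map (fun l => (l - 1) - √((l + 1) ^ 2 + 4 * (l + r₁)))
        + matrixSpec
          !![2 * (r₁ : ℝ), 2 * ((q₁ : ℝ) - r₁), 2 * (p₂ : ℝ);
             2 * ((p₁ : ℝ) - 2), 2 * ((q₁ : ℝ) - 1), 0;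
             2 * (p₁ : ℝ), 0, 2 * ((p₂ : ℝ) - 1 - r₂)]) ∧
    -- for `r₁ = 1` the number `q₁ - p₁` is negative: `p₁ - q₁` copies of `-2` are to be removed
    (r₁ = 1 → 2 ≤ q₁ →
      eccSpec (centralEdgeJoin G₁ G₂) + Multiset.replicate (p₁ - q₁) (-2 : ℝ) =
        β.map (fun b => -2 * (1 + b))
        + lam.map (fun l => (l - 1) + √((l + 1) ^ 2 + 4 * (l + r₁)))
        + lam.map (fun l => (l - 1) - √((l + 1) ^ 2 + 4 * (l + r₁)))
        + matrixSpec
          !![2 * (r₁ : ℝ), 2 * ((q₁ : ℝ) - r₁), 2 * (p₂ : ℝ);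
             2 * ((p₁ : ℝ) - 2), 2 * ((q₁ : ℝ) - 1), 0;
             2 * (p₁ : ℝ), 0, 2 * ((p₂ : ℝ) - 1 - r₂)]) := by
  have hhand : p₁ * r₁ = 2 * q₁ := by
    rw [← hp₁, ← hq₁, ← G₁.sum_degrees_eq_twice_card_edges]
    simp [hr₁.degree_eq]
  have hspec : 0 < r₁ → 2 ≤ q₁ → _ := fun hpos hq => by
    have : Nontrivial G₁.edgeSet := by
      rw [← Fintype.one_lt_card_iff_nontrivial, ← SimpleGraph.edgeFinset_card, hq₁]
      exact hq
    exact eccSpec_centralEdgeJoin_add_replicate hp₁ hq₁ hp₂ hr₁ hr₂ htri hpos hlam hβ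
  refine ⟨fun hr => ?_, fun hr hq => ?_⟩
  · have hpq : p₁ ≤ q₁ := by nlinarith
    -- With `p₁ ≤ q₁` and `2 ≤ r₁` this gives `2 ≤ q₁`, as `hspec` requires.
    have hrp : r₁ < p₁ := by
      obtain ⟨u⟩ := nonempty_of_adjSpec_eq_cons hlam
      rw [← hp₁, ← hr₁.degree_eq u]
      exact G₁.degree_lt_card_verts u
    refine ⟨hpq, add_right_cancel (b := Multiset.replicate p₁ (-2 : ℝ)) ?_⟩
    rw [hspec (by omega) (by omega)]
    conv_lhs => rw [← Nat.sub_add_cancel hpq, Multiset.replicate_add]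
    push_cast [Nat.sub_add_cancel hpq]
    abel
  · have hqp : q₁ ≤ p₁ := by subst hr; omega
    refine add_left_cancel (a := Multiset.replicate q₁ (-2 : ℝ)) ?_
    rw [add_left_comm, ← Multiset.replicate_add, Nat.add_sub_cancel' hqp,
      hspec (by omega) hq]
    abel
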